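/- Let $d>0$ and $\mathcal D_d=\{z\in\mathbf C : |\operatorname{Im} z|<d\}$. Let $B(\mathcal D_d)$ be the set of all functions $\zeta$ analytic on $\mathcal D_d$ such that $\lim_{x\to\pm\infty}\int_{-d}^{d}|\zeta(x+\mathrm i y)|\,\mathrm dy=0$ and such that $\lim_{y\to d-0}\int_{-\infty}^{\infty}(|\zeta(x+\mathrm i y)|+|\zeta(x-\mathrm i y)|)\,\mathrm dx$ exists and is finite. Let $w:\mathcal D_d\to\mathbf C$ belong to $B(\mathcal D_d)$, have no zero in $\mathcal D_d$, take real values in $(0,1]$ on the real axis, and be such that $\log w$ is strictly concave on $\mathbf R$. Let $\boldsymbol H^\infty(\mathcal D_d,w)$ be the space of all functions $f$ analytic on $\mathcal D_d$ with $\|f\|:=\sup_{z\in\mathcal D_d}|f(z)/w(z)|<\infty$. Put $T_d(z)=\tanh\left(\frac{\pi}{4d}z\right)$, and for $x\in\mathbf R$ put $K(x)=-\log|T_d(x)|$ $(x\ne0)$ and $Q(x)=-\log w(x)$. Let $n\ge 2$ be an integer and $\mathcal R_n=\{a\in\mathbf R^n : a_1<\dots<a_n\}$. For $a\in\mathcal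 R_n$ let \[ I_n^{\mathrm D}(a)=\sum_{i=1}^n\sum_{j\ne i}K(a_i-a_j)+\frac{2(n-1)}{n}\sum_{i=1}^nQ(a_i), \] \[ B_{n;k}(x;a)=\prod_{j\ne k}\frac{T_d(x)-T_d(a_j)}{1-\overline{T_d(a_j)}\,T_d(x)}\qquad(1\le k\le n), \] \[ L_n[a;f](x)=\sum_{k=1}^n f(a_k)\,\frac{B_{n;k}(x;a)\,w(x)}{B_{n;k}(a_k;a)\,w(a_k)}\,\frac{T_d'(x-a_k)}{T_d'(0)} . \] Let $a^*\in\mathcal R_n$ be the minimizer of $I_n^{\mathrm D}$ over $\mathcal R_n$, and let $F^{\mathrm D}_{K,Q}(n)=I_n^{\mathrm D}(a^*)-\frac{n-1}{n}\sum_{i=1}^nQ(a_i^*)$. Then \[ \sup_{\substack{f\in\boldsymbol H^\infty(\mathcal D_d,w)\\ \|f\|\le1}}\ \sup_{x\in\mathbf R}\left|f(x)-L_n[a^*;f](x)\right|\le\exp\left(-\frac{F^{\mathrm D}_{K,Q}(n)}{n}\right). \] -/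

import Mathlib

open scoped ENNReal NNReal Topology ComplexConjugate
open Filter MeasureTheory

noncomputable section

namespace WeightedHardy

/-- The open strip `D_d = {z : |Im z| < d}`. -/
def strip (d : ℝ) : Set ℂ := {z | |z.im| < d}

/-- The space `B(D_d)`: functions analytic on the strip whose integrals of the modulus over
vertical cross-sections tend to `0` at both ends, and whose integrals of the modulus over the pair
of horizontal lines `Im z = ± y` have a finite limit as `y → d - 0`. -/
structure MemB (d : ℝ) (ζ : ℂ → ℂ) : Prop where
  analytic : AnalyticOnNhd ℂ ζ (strip d)
  vertical_top : Tendsto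
    (fun x : ℝ => ∫⁻ y in Set.Ioo (-d) d, ‖ζ ((x : ℂ) + (y : ℂ) * Complex.I)‖ₑ) atTop (𝓝 0)
  vertical_bot : Tendsto
    (fun x : ℝ => ∫⁻ y in Set.Ioo (-d) d, ‖ζ ((x : ℂ) + (y : ℂ) * Complex.I)‖ₑ) atBot (𝓝 0)
  horizontal : ∃ L : ℝ≥0, Tendsto
    (fun y : ℝ => ∫⁻ x : ℝ, (‖ζ ((x : ℂ) + (y : ℂ) * Complex.I)‖ₑ
      + ‖ζ ((x : ℂ) - (y : ℂ) * Complex.I)‖ₑ)) (𝓝[<] d) (𝓝 (L : ℝ≥0∞))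

/-- The standing assumptions on a weight function: it lies in `B(D_d)`, has no zero in the strip,
takes real values in `(0, 1]` on the real axis, and its logarithm is strictly concave on `ℝ`. -/
structure IsWeight (d : ℝ) (w : ℂ → ℂ) : Prop where
  memB : MemB d w
  ne_zero : ∀ z ∈ strip d, w z ≠ 0
  real_values : ∀ x : ℝ, ∃ r ∈ Set.Ioc (0 : ℝ) 1, w (x : ℂ) = (r : ℂ)
  strictConcave_log : StrictConcaveOn ℝ Set.univ (fun x : ℝ => Real.log (w (x : ℂ)).re)

/-- The weighted norm `‖f‖ = sup_{z ∈ D_d} |f(z) / w(z)|`, with value in `[0, ∞]`. -/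
def hardyNorm (d : ℝ) (w f : ℂ → ℂ) : ℝ≥0∞ := ⨆ z ∈ strip d, ‖f z / w z‖ₑ

/-- The weighted Hardy space `H^∞(D_d, w)`. Functions are total functions on `ℂ`; only their
values on the strip matter. -/
def hardySpace (d : ℝ) (w : ℂ → ℂ) : Set (ℂ → ℂ) :=
  {f | AnalyticOnNhd ℂ f (strip d) ∧ hardyNorm d w f < ∞}

/-- `T_d(z) = tanh (π z / (4 d))`. -/
def tanhMap (d : ℝ) (z : ℂ) : ℂ := Complex.tanh ((Real.pi : ℂ) / (4 * (d : ℂ)) * z)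

/-- The transformed Blaschke product of the points `a` without the `k`-th factor,
`B_{n;k}(z; a, D_d)`. -/
def blaschkeOmit (d : ℝ) {n : ℕ} (a : Fin n → ℝ) (k : Fin n) (z : ℂ) : ℂ :=
  ∏ j ∈ Finset.univ.erase k,
    (tanhMap d z - tanhMap d (a j)) / (1 - conj (tanhMap d (a j)) * tanhMap d z)

/-- The `n`-point interpolation formula `L_n[a; f]`. -/
def interpolant (d : ℝ) (w : ℂ → ℂ) {n : ℕ} (a : Fin n → ℝ) (f : ℂ → ℂ) (z : ℂ) : ℂ :=
  ∑ k, f (a k) * ((blaschkeOmit d a k z * w z) / (blaschkeOmit d a k (a k) * w (a k)))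
    * (deriv (tanhMap d) (z - a k) / deriv (tanhMap d) 0)

/-- The worst-case error `sup_{f ∈ H^∞(D_d, w), ‖f‖ ≤ 1} sup_{x ∈ ℝ} |f(x) - L_n[a; f](x)|`,
with value in `[0, ∞]`. -/
def worstError (d : ℝ) (w : ℂ → ℂ) {n : ℕ} (a : Fin n → ℝ) : ℝ≥0∞ :=
  ⨆ f ∈ {f ∈ hardySpace d w | hardyNorm d w f ≤ 1},
    ⨆ x : ℝ, ‖f (x : ℂ) - interpolant d w a f (x : ℂ)‖ₑ

/-- `K(x) = - log |T_d(x)|`. It is used only at `x ≠ 0`. -/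
def kernelK (d : ℝ) (x : ℝ) : ℝ := -Real.log ‖tanhMap d (x : ℂ)‖

/-- The external field `Q(x) = - log w(x)`, for `w` real and positive on `ℝ`. -/
def fieldQ (w : ℂ → ℂ) (x : ℝ) : ℝ := -Real.log (w (x : ℂ)).re

/-- The ordered configurations `R_n = {a : a_1 < ⋯ < a_n}`. -/
def configurations (n : ℕ) : Set (Fin n → ℝ) := {a | StrictMono a}

/-- The discrete energy `I_n^D`. -/
def discreteEnergy (d : ℝ) (w : ℂ → ℂ) {n : ℕ} (a : Fin n → ℝ) : ℝ :=
  (∑ i, ∑ j ∈ Finset.univ.erase i, kernelK d (a i - a j))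
    + 2 * ((n : ℝ) - 1) / n * ∑ i, fieldQ w (a i)

/-- `a` minimizes the discrete energy over `R_n`. -/
def IsEnergyMinimizer (d : ℝ) (w : ℂ → ℂ) {n : ℕ} (a : Fin n → ℝ) : Prop :=
  a ∈ configurations n ∧ ∀ b ∈ configurations n, discreteEnergy d w a ≤ discreteEnergy d w b

/-- The number `I_n^D(a) - (n - 1) / n * ∑ Q(a_i)`; it is `F_{K,Q}^D(n)` when `a` is the
minimizer of `I_n^D`. -/
def discreteF (d : ℝ) (w : ℂ → ℂ) {n : ℕ} (a : Fin n → ℝ) : ℝ :=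
  discreteEnergy d w a - ((n : ℝ) - 1) / n * ∑ i, fieldQ w (a i)

end WeightedHardy

end

/-! Fix real `x` and map the unit disc conformally onto the strip with `0 ↦ x`. Then `f / w` becomes
`g` with `|g| ≤ 1`, the sampling points become real `β_k = tanh (π (a_k - x) / (4d))`, and `L_n[a;
f](x)` becomes `w x` times a rational interpolant of `g` evaluated at `0`.

Multiplied by `∏ (1 - β_j z)`, the interpolation error is holomorphic and vanishes at every `β_k`,
so it equals `∏ (z - β_j) * H z`. On the unit circle the two products have equal modulus, hence `|H
+ ∑ c_k / (z - β_k)| ≤ 1` there. Each `1 / (z - β_k)` has circle average `0`, so `|H 0| ≤ 1` and the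
error is at most `|w x| ∏ |β_j| = exp (-(∑ K(x - a_j) + Q(x)))` off the nodes
(`norm_sub_interpolant_le`).

Minimality enters by moving one point `a_k` to `x`. Summing the resulting inequalities over `k`
bounds the exponent's potential below by `F / n` (`IsEnergyMinimizer.discreteF_div_le`). -/

/-! ### Interpolation in the unit disc -/

/-- A holomorphic function vanishing at finitely many distinct points of an open set is divisible
by the corresponding product of linear factors. -/
theorem DifferentiableOn.exists_eq_prod_sub_mul {ι : Type*} {U : Set ℂ} (hU : IsOpen U)
    {β : ι → ℂ} (hβ : Function.Injective β) (hβU : ∀ k, β k ∈ U) (s : Finset ι) {G : ℂ → ℂ}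
    (hG : DifferentiableOn ℂ G U) (hz : ∀ k ∈ s, G (β k) = 0) :
    ∃ H : ℂ → ℂ, DifferentiableOn ℂ H U ∧ ∀ z, G z = (∏ k ∈ s, (z - β k)) * H z := by
  classical
  induction s using Finset.induction_on with
  | empty => exact ⟨G, hG, by simp⟩
  | insert i s hi ih =>
    obtain ⟨H, hH, hGH⟩ := ih fun k hk => hz k (Finset.mem_insert_of_mem hk)
    have h0 : H (β i) = 0 := by
      have h := hGH (β i)
      rw [hz i (Finset.mem_insert_self i s)] at h
      refine (mul_eq_zero.mp h.symm).resolve_left (Finset.prod_ne_zero_iff.mpr fun k hk => ?_)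
      exact sub_ne_zero.mpr fun e => hi (hβ e ▸ hk)
    refine ⟨dslope H (β i), (Complex.differentiableOn_dslope (hU.mem_nhds (hβU i))).mpr hH,
      fun z => ?_⟩
    have h := sub_smul_dslope H (β i) z
    rw [h0, sub_zero, smul_eq_mul] at h
    rw [hGH, Finset.prod_insert hi, ← h]
    ring

theorem norm_circleAverage_le_of_norm_le {f : ℂ → ℂ} {c : ℂ} {R C : ℝ}
    (hf : ∀ z ∈ Metric.sphere c |R|, ‖f z‖ ≤ C) : ‖Real.circleAverage f c R‖ ≤ C := by
  have h := intervalIntegral.norm_integral_le_of_norm_le_const (a := 0) (b := 2 * Real.pi)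
    (f := fun θ => f (circleMap c R θ)) (C := C)
    fun θ _ => hf _ (circleMap_mem_sphere' c R θ)
  rw [Real.circleAverage_def, norm_smul, Real.norm_of_nonneg (by positivity)]
  rw [sub_zero, abs_of_pos Real.two_pi_pos] at h
  calc (2 * Real.pi)⁻¹ * _ ≤ (2 * Real.pi)⁻¹ * (C * (2 * Real.pi)) := by gcongr
    _ = C := by field_simp

/-- The circle average over the unit circle of `1 / (z - β)` vanishes for `β` in the disc. -/
theorem circleAverage_inv_sub_eq_zero {β : ℂ} (hβ : ‖β‖ < 1) :
    Real.circleAverage (fun z => (z - β)⁻¹) 0 1 = 0 := by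
  have hne : ∀ z ∈ Metric.closedBall (0 : ℂ) 1, 1 - β * z ≠ 0 := fun z hz h => by
    have h1 : ‖β * z‖ = 1 := by rw [← sub_eq_zero.mp h, norm_one]
    rw [norm_mul] at h1
    have h2 : ‖z‖ ≤ 1 := by simpa using hz
    nlinarith [norm_nonneg β, norm_nonneg z]
  have hd : DifferentiableOn ℂ (fun z => z / (1 - β * z)) (Metric.closedBall 0 1) :=
    differentiableOn_id.div (by fun_prop) hne
  have h : Real.circleAverage (fun z => z / (1 - β * z)) 0 1 = 0 / (1 - β * 0) :=
    (DifferentiableOn.diffContOnCl_ball hd (by simp)).circleAverage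
  rw [zero_div] at h
  -- Inverting the circle turns `1 / (z - β)` into `z / (1 - β z)`, which is holomorphic on the
  -- closed disc and vanishes at `0`.
  rw [← Real.circleAverage_zero_one_congr_inv]
  refine Eq.trans ?_ h
  refine Real.circleAverage_congr_sphere fun z hz => ?_
  have hz1 : ‖z‖ = 1 := by simpa using hz
  have hz0 : z ≠ 0 := fun h0 => by simp [h0] at hz1
  have := hne z (by simp [hz1])
  have h3 : z⁻¹ - β = (1 - β * z) / z := by field_simp
  simp only [h3, inv_div]

theorem norm_one_sub_mul_eq_norm_sub {z : ℂ} (hz : ‖z‖ = 1) (β : ℝ) :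
    ‖1 - β * z‖ = ‖z - β‖ := by
  have h : z * conj z = 1 := by rw [Complex.mul_conj, Complex.normSq_eq_norm_sq, hz]; simp
  have : 1 - (β : ℂ) * z = z * conj (z - β) := by
    rw [map_sub, Complex.conj_ofReal, mul_sub, h]; ring
  rw [this, norm_mul, hz, one_mul, Complex.norm_conj]

/-- The weights `(1 - β_k²) / B_k(β_k)` of the interpolation rule at real points of the disc. -/
noncomputable def discWeight {ι : Type*} [Fintype ι] [DecidableEq ι] (β : ι → ℝ) (k : ι) : ℂ :=
  (1 - (β k : ℂ) ^ 2) *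
    ∏ j ∈ Finset.univ.erase k, ((1 - (β j : ℂ) * β k) / ((β k : ℂ) - β j))

/-- Analyticity past the unit circle makes boundary values and circle averages available; the
general case follows by dilation. -/
theorem norm_sub_interpolation_zero_le_of_differentiableOn {ι : Type*} [Fintype ι] [DecidableEq ι]
    {β : ι → ℝ} (hinj : Function.Injective β) (hβ : ∀ k, |β k| < 1) {R : ℝ} (hR : 1 < R)
    {g : ℂ → ℂ} (hg : DifferentiableOn ℂ g (Metric.ball 0 R)) (hg1 : ∀ z, ‖z‖ = 1 → ‖g z‖ ≤ 1) :
    ‖g 0 - ∑ k, g (β k) * discWeight β k * ∏ j ∈ Finset.univ.erase k, (-(β j : ℂ))‖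
      ≤ ∏ j, |β j| := by
  set c : ι → ℂ := fun k => g (β k) * discWeight β k with hc
  set G : ℂ → ℂ := fun z => g z * ∏ j, (1 - (β j : ℂ) * z)
    - ∑ k, c k * ∏ j ∈ Finset.univ.erase k, (z - β j) with hGdef
  have hcinj : Function.Injective fun k => (β k : ℂ) := Complex.ofReal_injective.comp hinj
  have hGd : DifferentiableOn ℂ G (Metric.ball 0 R) := by
    refine (hg.mul ?_).sub ?_
    · exact Differentiable.differentiableOn (by fun_prop)
    · exact Differentiable.differentiableOn (by fun_prop)
  -- At `β k` only the `k`-th summand survives, and `discWeight` is chosen so that it cancels `g (β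
  -- k) * ∏ (1 - β_j β_k)`.
  have hG0 : ∀ k, G (β k) = 0 := fun k => by
    have h1 : ∑ i, c i * ∏ j ∈ Finset.univ.erase i, ((β k : ℂ) - β j)
        = c k * ∏ j ∈ Finset.univ.erase k, ((β k : ℂ) - β j) := by
      refine Finset.sum_eq_single k (fun i _ hik => ?_) (by simp)
      rw [Finset.prod_eq_zero (i := k) (by simp [hik.symm]) (sub_self _), mul_zero]
    have h2 : ∏ j ∈ Finset.univ.erase k, ((β k : ℂ) - β j) ≠ 0 :=
      Finset.prod_ne_zero_iff.mpr fun j hj =>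
        sub_ne_zero.mpr fun e => (Finset.ne_of_mem_erase hj) (hcinj e).symm
    simp only [hGdef]
    rw [h1, ← Finset.mul_prod_erase _ _ (Finset.mem_univ k)]
    simp only [hc, discWeight, Finset.prod_div_distrib]
    field_simp
    ring
  obtain ⟨H, hH, hGH⟩ := hGd.exists_eq_prod_sub_mul Metric.isOpen_ball hcinj
    (fun k => by simpa using (hβ k).trans hR) Finset.univ fun k _ => hG0 k
  have hcn : ∀ k, ‖(β k : ℂ)‖ < 1 := fun k => by simpa using hβ k
  have hne : ∀ z : ℂ, ‖z‖ = 1 → ∀ k, z - β k ≠ 0 := fun z hz k h => by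
    have := hcn k
    rw [← sub_eq_zero.mp h, hz] at this
    exact lt_irrefl _ this
  have hcb : Metric.closedBall (0 : ℂ) 1 ⊆ Metric.ball 0 R :=
    Metric.closedBall_subset_ball hR
  have hHavg : Real.circleAverage H 0 1 = H 0 :=
    (DifferentiableOn.diffContOnCl_ball (U := Metric.ball 0 R) (c := (0 : ℂ))
      (R := |1|) hH (by simpa using hcb)).circleAverage
  have hint : ∀ k ∈ Finset.univ, CircleIntegrable (fun z => c k • (z - (β k : ℂ))⁻¹) 0 1 :=
    fun k _ => ContinuousOn.circleIntegrable' (by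
      have h1 : ContinuousOn (fun z : ℂ => z - (β k : ℂ)) (Metric.sphere 0 |1|) := by fun_prop
      exact (h1.inv₀ fun z hz => hne z (by simpa using hz) k).const_smul (c k))
  have hHint : CircleIntegrable H 0 1 := ContinuousOn.circleIntegrable'
    (hH.continuousOn.mono (by simpa using Metric.sphere_subset_closedBall.trans hcb))
  have hsum : Real.circleAverage (fun z => ∑ k, c k • (z - (β k : ℂ))⁻¹) 0 1 = 0 := by
    rw [Real.circleAverage_fun_sum hint]
    refine Finset.sum_eq_zero fun k _ => ?_
    rw [Real.circleAverage_fun_smul, circleAverage_inv_sub_eq_zero (hcn k), smul_zero]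
  have hH0 : ‖H 0‖ ≤ 1 := by
    have h := Real.circleAverage_fun_add hHint (CircleIntegrable.fun_sum _ hint)
    rw [hHavg, hsum, add_zero] at h
    rw [← h]
    refine norm_circleAverage_le_of_norm_le fun z hz => ?_
    have hz1 : ‖z‖ = 1 := by simpa using hz
    have hP : ∏ j, (z - (β j : ℂ)) ≠ 0 := Finset.prod_ne_zero_iff.mpr fun j _ => hne z hz1 j
    -- Dividing by the linear factors leaves `H` plus simple poles, which do not affect the average.
    have key : (∏ j, (z - (β j : ℂ))) * (H z + ∑ k, c k • (z - (β k : ℂ))⁻¹)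
        = g z * ∏ j, (1 - (β j : ℂ) * z) := by
      rw [mul_add, ← hGH, Finset.mul_sum]
      have : ∀ k, (∏ j, (z - (β j : ℂ))) * (c k • (z - (β k : ℂ))⁻¹)
          = c k * ∏ j ∈ Finset.univ.erase k, (z - β j) := fun k => by
        rw [← Finset.mul_prod_erase _ _ (Finset.mem_univ k), smul_eq_mul]
        have := hne z hz1 k
        field_simp
      simp only [this, hGdef, sub_add_cancel]
    have h2 := congrArg norm key
    simp only [norm_mul, norm_prod, norm_one_sub_mul_eq_norm_sub hz1] at h2
    have hPpos : 0 < ∏ j, ‖z - (β j : ℂ)‖ := by rw [← norm_prod]; exact norm_pos_iff.mpr hP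
    have h3 := hg1 z hz1
    nlinarith
  have hfin : g 0 - ∑ k, g (β k) * discWeight β k * ∏ j ∈ Finset.univ.erase k, (-(β j : ℂ))
      = (∏ j, (0 - (β j : ℂ))) * H 0 := by
    rw [← hGH]
    simp [hGdef, hc]
  rw [hfin, norm_mul, norm_prod]
  simp only [zero_sub, norm_neg, Complex.norm_real, Real.norm_eq_abs]
  exact mul_le_of_le_one_right (Finset.prod_nonneg fun _ _ => abs_nonneg _) hH0

/-- Interpolation error at the centre of the disc, for functions bounded by `1`. -/
theorem norm_sub_interpolation_zero_le {ι : Type*} [Fintype ι] [DecidableEq ι]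
    {β : ι → ℝ} (hinj : Function.Injective β) (hβ : ∀ k, |β k| < 1)
    {g : ℂ → ℂ} (hg : DifferentiableOn ℂ g (Metric.ball 0 1)) (hg1 : ∀ z, ‖z‖ < 1 → ‖g z‖ ≤ 1) :
    ‖g 0 - ∑ k, g (β k) * discWeight β k * ∏ j ∈ Finset.univ.erase k, (-(β j : ℂ))‖
      ≤ ∏ j, |β j| := by
  have hlim : ∀ z : ℂ, ‖z‖ < 1 →
      Tendsto (fun r : ℝ => g (r * z)) (𝓝[<] 1) (𝓝 (g z)) := fun z hz => by
    have h1 : ContinuousAt g z := (hg.differentiableAt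
      (Metric.isOpen_ball.mem_nhds (by simpa using hz))).continuousAt
    have h2 : Tendsto (fun r : ℝ => (r : ℂ) * z) (𝓝 1) (𝓝 z) := by
      have : Continuous fun r : ℝ => (r : ℂ) * z := by fun_prop
      simpa using this.tendsto 1
    exact h1.tendsto.comp (h2.mono_left nhdsWithin_le_nhds)
  have hl : Tendsto (fun r : ℝ => ‖g (r * 0) - ∑ k, g (r * β k) * discWeight β k
      * ∏ j ∈ Finset.univ.erase k, (-(β j : ℂ))‖) (𝓝[<] 1) (𝓝 ‖g 0 - ∑ k, g (β k)
      * discWeight β k * ∏ j ∈ Finset.univ.erase k, (-(β j : ℂ))‖) := by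
    refine ((hlim 0 (by simp)).sub (tendsto_finsetSum _ fun k _ => ?_)).norm
    exact ((hlim _ (by simpa using hβ k)).mul_const _).mul_const _
  refine le_of_tendsto hl ?_
  filter_upwards [Ioo_mem_nhdsLT (zero_lt_one (α := ℝ))] with r hr
  have hrn : ‖(r : ℂ)‖ = r := by simp [abs_of_pos hr.1]
  -- The dilate `g (r z)` is holomorphic on the disc of radius `r⁻¹ > 1`; then `r → 1`.
  refine norm_sub_interpolation_zero_le_of_differentiableOn (g := fun z => g (r * z)) hinj hβ
    ((one_lt_inv₀ hr.1).mpr hr.2) (hg.comp (by fun_prop) fun z hz => ?_) fun z hz => ?_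
  · rw [mem_ball_zero_iff] at hz ⊢
    rw [norm_mul, hrn]
    calc r * ‖z‖ < r * r⁻¹ := by gcongr; exact hr.1
      _ = 1 := mul_inv_cancel₀ hr.1.ne'
  · exact hg1 _ (by rw [norm_mul, hrn, hz, mul_one]; exact hr.2)

/-! ### The discrete energy and its minimizers -/

namespace WeightedHardy

/-- The sum of a symmetric function over the off-diagonal pairs, with the pairs through a given
index split off. -/
theorem sum_offDiag_eq_two_mul_add {ι : Type*} [Fintype ι] [DecidableEq ι] {M : ι → ι → ℝ}
    (hM : ∀ i j, M i j = M j i) (k : ι) :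
    ∑ i, ∑ j ∈ Finset.univ.erase i, M i j = 2 * ∑ j ∈ Finset.univ.erase k, M k j
      + ∑ i ∈ Finset.univ.erase k, ∑ j ∈ (Finset.univ.erase i).erase k, M i j := by
  rw [← Finset.add_sum_erase _ _ (Finset.mem_univ k)]
  have : ∀ i ∈ Finset.univ.erase k, ∑ j ∈ Finset.univ.erase i, M i j
      = M k i + ∑ j ∈ (Finset.univ.erase i).erase k, M i j := fun i hi => by
    rw [← Finset.add_sum_erase _ _ (Finset.mem_erase.mpr
      ⟨(Finset.ne_of_mem_erase hi).symm, Finset.mem_univ k⟩), hM]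
  rw [Finset.sum_congr rfl this, Finset.sum_add_distrib]
  ring

theorem tanhMap_ofReal (d x : ℝ) :
    tanhMap d x = (Real.tanh (Real.pi / (4 * d) * x) : ℝ) := by
  simp [tanhMap]

theorem kernelK_eq (d x : ℝ) : kernelK d x = -Real.log |Real.tanh (Real.pi / (4 * d) * x)| := by
  rw [kernelK, tanhMap_ofReal, Complex.norm_real, Real.norm_eq_abs]

theorem kernelK_neg (d x : ℝ) : kernelK d (-x) = kernelK d x := by
  simp [kernelK_eq]

theorem kernelK_nonneg (d x : ℝ) : 0 ≤ kernelK d x := by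
  rw [kernelK_eq]
  exact neg_nonneg.mpr (Real.log_nonpos (abs_nonneg _) (Real.abs_tanh_lt_one _).le)

theorem IsWeight.re_mem_Ioc {d : ℝ} {w : ℂ → ℂ} (hw : IsWeight d w) (x : ℝ) :
    (w x).re ∈ Set.Ioc (0 : ℝ) 1 := by
  obtain ⟨r, hr, h⟩ := hw.real_values x
  rw [h]
  exact hr

theorem IsWeight.norm_eq_re {d : ℝ} {w : ℂ → ℂ} (hw : IsWeight d w) (x : ℝ) :
    ‖w x‖ = (w x).re := by
  obtain ⟨r, hr, h⟩ := hw.real_values x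
  rw [h, Complex.norm_real, Real.norm_of_nonneg hr.1.le, Complex.ofReal_re]

theorem IsWeight.fieldQ_nonneg {d : ℝ} {w : ℂ → ℂ} (hw : IsWeight d w) (x : ℝ) :
    0 ≤ fieldQ w x :=
  neg_nonneg.mpr (Real.log_nonpos (hw.re_mem_Ioc x).1.le (hw.re_mem_Ioc x).2)

theorem discreteEnergy_comp_perm (d : ℝ) (w : ℂ → ℂ) {n : ℕ} (a : Fin n → ℝ)
    (σ : Equiv.Perm (Fin n)) : discreteEnergy d w (a ∘ σ) = discreteEnergy d w a := by
  have h1 : ∑ i, ∑ j ∈ Finset.univ.erase i, kernelK d (a (σ i) - a (σ j))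
      = ∑ i, ∑ j ∈ Finset.univ.erase i, kernelK d (a i - a j) := by
    rw [← Equiv.sum_comp σ fun i => ∑ j ∈ Finset.univ.erase i, kernelK d (a i - a j)]
    refine Finset.sum_congr rfl fun i _ => Finset.sum_equiv σ (by simp) (by simp)
  have h2 : ∑ i, fieldQ w (a (σ i)) = ∑ i, fieldQ w (a i) :=
    Equiv.sum_comp σ fun i => fieldQ w (a i)
  simp only [discreteEnergy, Function.comp_apply, h1, h2]

/-- A minimizer over ordered configurations minimizes over all configurations of distinct
points. -/
theorem IsEnergyMinimizer.le_of_injective {d : ℝ} {w : ℂ → ℂ} {n : ℕ} {a : Fin n → ℝ}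
    (ha : IsEnergyMinimizer d w a) {b : Fin n → ℝ} (hb : Function.Injective b) :
    discreteEnergy d w a ≤ discreteEnergy d w b := by
  rw [← discreteEnergy_comp_perm d w b (Tuple.sort b)]
  exact ha.2 _ ((Tuple.monotone_sort b).strictMono_of_injective
    (hb.comp (Tuple.sort b).injective))

/-- Moving one point of a minimizer does not decrease its share of the energy. -/
theorem IsEnergyMinimizer.point_energy_le {d : ℝ} {w : ℂ → ℂ} {n : ℕ} {a : Fin n → ℝ}
    (ha : IsEnergyMinimizer d w a) {x : ℝ} (hx : ∀ j, x ≠ a j) (k : Fin n) :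
    ∑ j ∈ Finset.univ.erase k, kernelK d (a k - a j) + ((n : ℝ) - 1) / n * fieldQ w (a k)
      ≤ ∑ j ∈ Finset.univ.erase k, kernelK d (x - a j) + ((n : ℝ) - 1) / n * fieldQ w x := by
  have hinj : Function.Injective a := StrictMono.injective ha.1
  -- The moved configuration may be out of order, so only distinctness is checked.
  have hb : Function.Injective (Function.update a k x) := by
    intro i j hij
    by_cases hi : i = k <;> by_cases hj : j = k
    · rw [hi, hj]
    · subst hi; exact absurd (by simpa [Function.update_of_ne hj] using hij) (hx j)
    · subst hj; exact absurd (by simpa [Function.update_of_ne hi] using hij.symm) (hx i)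
    · exact hinj (by simpa [Function.update_of_ne hi, Function.update_of_ne hj] using hij)
  have hle := ha.le_of_injective hb
  have hsymm : ∀ c : Fin n → ℝ, ∀ i j, kernelK d (c i - c j) = kernelK d (c j - c i) :=
    fun c i j => by rw [← kernelK_neg, neg_sub]
  unfold discreteEnergy at hle
  rw [sum_offDiag_eq_two_mul_add (hsymm a) k,
    sum_offDiag_eq_two_mul_add (hsymm (Function.update a k x)) k,
    ← Finset.add_sum_erase _ (fun i => fieldQ w (a i)) (Finset.mem_univ k),
    ← Finset.add_sum_erase _ (fun i => fieldQ w (Function.update a k x i))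
      (Finset.mem_univ k)] at hle
  have hup : ∀ i ∈ Finset.univ.erase k, Function.update a k x i = a i := fun i hi =>
    Function.update_of_ne (Finset.ne_of_mem_erase hi) _ _
  have e1 : ∑ i ∈ Finset.univ.erase k, fieldQ w (Function.update a k x i)
      = ∑ i ∈ Finset.univ.erase k, fieldQ w (a i) :=
    Finset.sum_congr rfl fun i hi => by rw [hup i hi]
  have e2 : ∑ j ∈ Finset.univ.erase k, kernelK d (x - Function.update a k x j)
      = ∑ j ∈ Finset.univ.erase k, kernelK d (x - a j) :=
    Finset.sum_congr rfl fun j hj => by rw [hup j hj]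
  have e3 : ∑ i ∈ Finset.univ.erase k, ∑ j ∈ (Finset.univ.erase i).erase k,
        kernelK d (Function.update a k x i - Function.update a k x j)
      = ∑ i ∈ Finset.univ.erase k, ∑ j ∈ (Finset.univ.erase i).erase k, kernelK d (a i - a j) :=
    Finset.sum_congr rfl fun i hi => Finset.sum_congr rfl fun j hj => by
      rw [hup i hi, hup j (Finset.mem_erase.mpr ⟨Finset.ne_of_mem_erase hj, Finset.mem_univ j⟩)]
  -- Pairs avoiding `k` cancel. What remains carries a common factor `2`, from the symmetry of the
  -- kernel and from the coefficient of the field.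
  rw [Function.update_self, e1, e2, e3, mul_div_assoc] at hle
  rw [mul_add, mul_add] at hle
  linarith

/-- The potential of a minimizing configuration plus the external field is at least `F / n`. -/
theorem IsEnergyMinimizer.discreteF_div_le {d : ℝ} {w : ℂ → ℂ} (hw : IsWeight d w) {n : ℕ}
    (hn : 2 ≤ n) {a : Fin n → ℝ} (ha : IsEnergyMinimizer d w a) {x : ℝ} (hx : ∀ j, x ≠ a j) :
    discreteF d w a / n ≤ ∑ j, kernelK d (x - a j) + fieldQ w x := by
  have hn' : (2 : ℝ) ≤ n := by exact_mod_cast hn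
  have hF : discreteF d w a = ∑ k, (∑ j ∈ Finset.univ.erase k, kernelK d (a k - a j)
      + ((n : ℝ) - 1) / n * fieldQ w (a k)) := by
    rw [discreteF, discreteEnergy, Finset.sum_add_distrib, ← Finset.mul_sum]
    ring
  -- Each `K(x - a_j)` is omitted for exactly one `k`, so it is counted `n - 1` times; the field is
  -- counted `n * ((n - 1) / n)` times.
  have h1 : discreteF d w a ≤ ((n : ℝ) - 1) * (∑ j, kernelK d (x - a j) + fieldQ w x) := by
    rw [hF]
    refine (Finset.sum_le_sum fun k _ => ha.point_energy_le hx k).trans_eq ?_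
    have : ∀ k ∈ (Finset.univ : Finset (Fin n)), ∑ j ∈ Finset.univ.erase k, kernelK d (x - a j)
        + ((n : ℝ) - 1) / n * fieldQ w x = (∑ j, kernelK d (x - a j)
        + ((n : ℝ) - 1) / n * fieldQ w x) - kernelK d (x - a k) := fun k hk => by
      rw [← Finset.add_sum_erase _ _ hk]; ring
    rw [Finset.sum_congr rfl this, Finset.sum_sub_distrib, Finset.sum_const, Finset.card_univ,
      Fintype.card_fin, nsmul_eq_mul]
    field_simp
    ring
  have h2 : 0 ≤ ∑ j, kernelK d (x - a j) + fieldQ w x :=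
    add_nonneg (Finset.sum_nonneg fun j _ => kernelK_nonneg d _) (hw.fieldQ_nonneg x)
  rw [div_le_iff₀ (by linarith)]
  -- Nonnegativity of the potential allows `n - 1` to be weakened to `n`.
  nlinarith

theorem IsEnergyMinimizer.mul_prod_abs_tanh_le {d : ℝ} (hd : 0 < d) {w : ℂ → ℂ}
    (hw : IsWeight d w) {n : ℕ} (hn : 2 ≤ n) {a : Fin n → ℝ} (ha : IsEnergyMinimizer d w a)
    (x : ℝ) : ‖w x‖ * ∏ j, |Real.tanh (Real.pi / (4 * d) * (a j - x))|
      ≤ Real.exp (-(discreteF d w a / n)) := by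
  -- At a node `kernelK` takes the default value `0` instead of `+∞`, so that case is separate;
  -- there the product vanishes.
  by_cases hx : ∀ j, x ≠ a j
  · have hne : ∀ j, |Real.tanh (Real.pi / (4 * d) * (a j - x))| ≠ 0 := fun j h => by
      rw [abs_eq_zero, ← Real.tanh_zero, Real.tanh_injective.eq_iff] at h
      have := Real.pi_pos
      have h2 : a j - x = 0 := (mul_eq_zero.mp h).resolve_left (by positivity)
      exact hx j (sub_eq_zero.mp h2).symm
    have hpos : 0 < ‖w x‖ * ∏ j, |Real.tanh (Real.pi / (4 * d) * (a j - x))| := by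
      rw [hw.norm_eq_re]
      exact mul_pos (hw.re_mem_Ioc x).1
        (Finset.prod_pos fun j _ => lt_of_le_of_ne (abs_nonneg _) (hne j).symm)
    rw [← Real.log_le_iff_le_exp hpos, hw.norm_eq_re, Real.log_mul (hw.re_mem_Ioc x).1.ne'
      (Finset.prod_ne_zero_iff.mpr fun j _ => hne j), Real.log_prod fun j _ => hne j]
    have h := ha.discreteF_div_le hw hn hx
    have h3 : ∑ j, kernelK d (x - a j)
        = -∑ j, Real.log |Real.tanh (Real.pi / (4 * d) * (a j - x))| := by
      rw [← Finset.sum_neg_distrib]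
      exact Finset.sum_congr rfl fun j _ => by rw [← kernelK_neg, neg_sub, kernelK_eq]
    rw [h3, fieldQ] at h
    linarith
  · push Not at hx
    obtain ⟨j, rfl⟩ := hx
    rw [Finset.prod_eq_zero (Finset.mem_univ j) (by simp), mul_zero]
    positivity

/-! ### Hyperbolic tangent and the conformal map -/

theorem tanh_sub_div (u v : ℝ) :
    (Real.tanh u - Real.tanh v) / (1 - Real.tanh v * Real.tanh u) = Real.tanh (u - v) := by
  have hu := (Real.cosh_pos u).ne'
  have hv := (Real.cosh_pos v).ne'
  have huv := (Real.cosh_pos (u - v)).ne'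
  have h1 : 1 - Real.tanh v * Real.tanh u = Real.cosh (u - v) / (Real.cosh u * Real.cosh v) := by
    rw [Real.tanh_eq_sinh_div_cosh, Real.tanh_eq_sinh_div_cosh, Real.cosh_sub]
    field_simp
  have h2 : Real.tanh u - Real.tanh v = Real.sinh (u - v) / (Real.cosh u * Real.cosh v) := by
    rw [Real.tanh_eq_sinh_div_cosh, Real.tanh_eq_sinh_div_cosh, Real.sinh_sub]
    field_simp
  rw [h1, h2, Real.tanh_eq_sinh_div_cosh]
  field_simp

theorem blaschkeOmit_ofReal (d : ℝ) {n : ℕ} (a : Fin n → ℝ) (k : Fin n) (x : ℝ) :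
    blaschkeOmit d a k x
      = ∏ j ∈ Finset.univ.erase k, (Real.tanh (Real.pi / (4 * d) * (x - a j)) : ℂ) := by
  refine Finset.prod_congr rfl fun j _ => ?_
  rw [tanhMap_ofReal, tanhMap_ofReal, Complex.conj_ofReal, mul_sub, ← tanh_sub_div]
  push_cast
  rfl

theorem deriv_tanhMap_ofReal (d x : ℝ) : deriv (tanhMap d) x
    = Real.pi / (4 * d) * (1 - (Real.tanh (Real.pi / (4 * d) * x) : ℂ) ^ 2) := by
  set c : ℂ := Real.pi / (4 * d) with hc
  have hcx : c * x = ((Real.pi / (4 * d) * x : ℝ) : ℂ) := by rw [hc]; push_cast; rfl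
  have hcosh : Complex.cosh (c * x) ≠ 0 := by
    rw [hcx, ← Complex.ofReal_cosh]
    exact Complex.ofReal_ne_zero.mpr (Real.cosh_pos _).ne'
  have hlin : HasDerivAt (fun z : ℂ => c * z) c (x : ℂ) := by
    simpa using (hasDerivAt_id (x : ℂ)).const_mul c
  have h := (hlin.csinh.div hlin.ccosh hcosh).deriv
  have he : tanhMap d = fun z => Complex.sinh (c * z) / Complex.cosh (c * z) := by
    funext z
    rw [tanhMap, Complex.tanh_eq_sinh_div_cosh]
  have h' : deriv (tanhMap d) x = (Complex.cosh (c * x) * c * Complex.cosh (c * x)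
      - Complex.sinh (c * x) * (Complex.sinh (c * x) * c)) / Complex.cosh (c * x) ^ 2 := by
    rw [he]; exact h
  rw [h', Complex.ofReal_tanh, ← hcx, Complex.tanh_eq_sinh_div_cosh]
  field_simp

theorem deriv_tanhMap_div_deriv_zero {d : ℝ} (hd : 0 < d) (x : ℝ) :
    deriv (tanhMap d) x / deriv (tanhMap d) 0
      = 1 - (Real.tanh (Real.pi / (4 * d) * x) : ℂ) ^ 2 := by
  have h0 := deriv_tanhMap_ofReal d 0
  have hc : (Real.pi : ℂ) / (4 * d) ≠ 0 := by
    have := Real.pi_ne_zero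
    have := hd.ne'
    simp_all
  rw [Complex.ofReal_zero, mul_zero, Real.tanh_zero] at h0
  rw [h0, deriv_tanhMap_ofReal, Complex.ofReal_zero, zero_pow two_ne_zero, sub_zero, mul_one,
    mul_div_cancel_left₀ _ hc]

/-- The conformal map of the unit disc onto the strip that sends `0` to `x`. -/
noncomputable def discToStrip (d x : ℝ) (ζ : ℂ) : ℂ :=
  x + (2 * d / Real.pi : ℝ) * Complex.log ((1 + ζ) / (1 - ζ))

/-- The real part is `(1 - |ζ|²) / |1 - ζ|²`. Its positivity keeps the principal logarithm analytic,
with imaginary part below `π / 2` in modulus. -/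
theorem re_cayley_pos {ζ : ℂ} (hζ : ‖ζ‖ < 1) : 0 < ((1 + ζ) / (1 - ζ)).re := by
  have hne : 1 - ζ ≠ 0 := fun h => by
    rw [← sub_eq_zero.mp h, norm_one] at hζ
    exact lt_irrefl _ hζ
  have hsq : ζ.re * ζ.re + ζ.im * ζ.im < 1 := by
    rw [← Complex.normSq_apply, Complex.normSq_eq_norm_sq]
    nlinarith [norm_nonneg ζ]
  rw [Complex.div_re, ← add_div]
  refine div_pos ?_ (Complex.normSq_pos.mpr hne)
  simp only [Complex.add_re, Complex.sub_re, Complex.one_re, Complex.add_im, Complex.sub_im,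
    Complex.one_im]
  nlinarith

theorem discToStrip_mem_strip {d : ℝ} (hd : 0 < d) (x : ℝ) {ζ : ℂ} (hζ : ‖ζ‖ < 1) :
    discToStrip d x ζ ∈ strip d := by
  have h := Complex.abs_arg_lt_pi_div_two_iff.mpr (Or.inl (re_cayley_pos hζ))
  have hpi := Real.pi_pos
  rw [strip, Set.mem_ofPred_eq, discToStrip, Complex.add_im, Complex.ofReal_im, zero_add,
    Complex.im_ofReal_mul, Complex.log_im, abs_mul, abs_of_pos (by positivity)]
  calc 2 * d / Real.pi * _ < 2 * d / Real.pi * (Real.pi / 2) := by gcongr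
    _ = d := by field_simp

theorem differentiableOn_discToStrip (d x : ℝ) :
    DifferentiableOn ℂ (discToStrip d x) (Metric.ball 0 1) := by
  have hne : ∀ ζ ∈ Metric.ball (0 : ℂ) 1, 1 - ζ ≠ 0 := fun ζ hζ h => by
    rw [mem_ball_zero_iff, ← sub_eq_zero.mp h, norm_one] at hζ
    exact lt_irrefl _ hζ
  have h1 : DifferentiableOn ℂ (fun ζ : ℂ => (1 + ζ) / (1 - ζ)) (Metric.ball 0 1) :=
    DifferentiableOn.div (by fun_prop) (by fun_prop) hne
  refine ((h1.clog fun ζ hζ => ?_).const_mul _).const_add _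
  exact Or.inl (re_cayley_pos (by simpa using hζ))

theorem discToStrip_zero (d x : ℝ) : discToStrip d x 0 = x := by
  simp [discToStrip]

/-- The Cayley transform sends `tanh u` to `exp (2u)`, and `(2d / π) * 2u = y - x`. -/
theorem discToStrip_tanh {d : ℝ} (hd : 0 < d) (x y : ℝ) :
    discToStrip d x (Real.tanh (Real.pi / (4 * d) * (y - x)) : ℝ) = y := by
  set u := Real.pi / (4 * d) * (y - x) with hu
  have h1 : (1 + Real.tanh u) / (1 - Real.tanh u) = Real.exp (2 * u) := by
    have hc := (Real.cosh_pos u).ne'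
    have h2 : 1 - Real.tanh u ≠ 0 := by linarith [Real.tanh_lt_one u]
    have h3 := Real.cosh_add_sinh u
    have h4 := Real.cosh_sub_sinh u
    have h5 : Real.exp (2 * u) * Real.exp (-u) = Real.exp u := by
      rw [← Real.exp_add]; ring_nf
    rw [div_eq_iff h2, Real.tanh_eq_sinh_div_cosh]
    field_simp
    rw [h3, h4, h5]
  have h2 : (1 + (Real.tanh u : ℂ)) / (1 - (Real.tanh u : ℂ)) = (Real.exp (2 * u) : ℝ) := by
    rw [← h1]; push_cast; rfl
  rw [discToStrip, h2, ← Complex.ofReal_log (Real.exp_pos _).le, Real.log_exp,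
    ← Complex.ofReal_mul, ← Complex.ofReal_add, hu]
  congr 1
  have := Real.pi_ne_zero
  field_simp
  ring

/-! ### Transfer to the strip and conclusion -/

theorem norm_div_le_of_hardyNorm_le {d : ℝ} {w f : ℂ → ℂ} (h : hardyNorm d w f ≤ 1) {z : ℂ}
    (hz : z ∈ strip d) : ‖f z / w z‖ ≤ 1 := by
  have h1 : ‖f z / w z‖ₑ ≤ 1 :=
    (le_iSup₂ (f := fun z (_ : z ∈ strip d) => ‖f z / w z‖ₑ) z hz).trans h
  rwa [← ofReal_norm, ENNReal.ofReal_le_one] at h1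

/-- The error of the interpolation formula is at most the transformed Blaschke product of all the
sampling points times the weight. -/
theorem norm_sub_interpolant_le {d : ℝ} (hd : 0 < d) {w : ℂ → ℂ} (hw : IsWeight d w) {n : ℕ}
    {a : Fin n → ℝ} (hinj : Function.Injective a) {f : ℂ → ℂ} (hf : f ∈ hardySpace d w)
    (hf1 : hardyNorm d w f ≤ 1) (x : ℝ) :
    ‖f x - interpolant d w a f x‖
      ≤ ‖w x‖ * ∏ j, |Real.tanh (Real.pi / (4 * d) * (a j - x))| := by
  have hreal : ∀ y : ℝ, (y : ℂ) ∈ strip d := fun y => by simpa [strip] using hd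
  set β : Fin n → ℝ := fun k => Real.tanh (Real.pi / (4 * d) * (a k - x)) with hβ
  set g : ℂ → ℂ := fun ζ => f (discToStrip d x ζ) / w (discToStrip d x ζ) with hg
  have hβinj : Function.Injective β := fun i j h => by
    have h1 := Real.tanh_injective h
    have hc : Real.pi / (4 * d) ≠ 0 := by have := Real.pi_pos; positivity
    exact hinj (sub_left_injective (mul_left_cancel₀ hc h1))
  have hmap : Set.MapsTo (discToStrip d x) (Metric.ball 0 1) (strip d) := fun ζ hζ =>
    discToStrip_mem_strip hd x (by simpa using hζ)
  have hgd : DifferentiableOn ℂ g (Metric.ball 0 1) :=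
    (hf.1.differentiableOn.comp (differentiableOn_discToStrip d x) hmap).div
      (hw.memB.analytic.differentiableOn.comp (differentiableOn_discToStrip d x) hmap)
      fun ζ hζ => hw.ne_zero _ (hmap hζ)
  have hmain := norm_sub_interpolation_zero_le hβinj (fun k => Real.abs_tanh_lt_one _) hgd
    fun ζ hζ => norm_div_le_of_hardyNorm_le hf1 (discToStrip_mem_strip hd x hζ)
  have hg0 : g 0 = f x / w x := by simp only [hg, discToStrip_zero]
  have hgβ : ∀ k, g (β k) = f (a k) / w (a k) := fun k => by
    simp only [hg, hβ, discToStrip_tanh hd]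
  have hwx := hw.ne_zero _ (hreal x)
  -- The Blaschke ratio gives the products in `β`, and the derivative ratio gives the factor `1 -
  -- β_k²` of `discWeight`.
  have hsum : interpolant d w a f x = w x *
      ∑ k, g (β k) * discWeight β k * ∏ j ∈ Finset.univ.erase k, (-(β j : ℂ)) := by
    rw [interpolant, Finset.mul_sum]
    refine Finset.sum_congr rfl fun k _ => ?_
    have h1 : blaschkeOmit d a k x = ∏ j ∈ Finset.univ.erase k, (-(β j : ℂ)) := by
      rw [blaschkeOmit_ofReal]
      refine Finset.prod_congr rfl fun j _ => ?_
      rw [← Complex.ofReal_neg, hβ, ← Real.tanh_neg]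
      congr 2
      ring
    have h2 : (blaschkeOmit d a k (a k))⁻¹
        = ∏ j ∈ Finset.univ.erase k, ((1 - (β j : ℂ) * β k) / ((β k : ℂ) - β j)) := by
      rw [blaschkeOmit_ofReal, ← Finset.prod_inv_distrib]
      refine Finset.prod_congr rfl fun j _ => ?_
      -- Subtracting the common shift `x` shows that the Blaschke factor is unchanged by the
      -- recentring.
      have : Real.pi / (4 * d) * (a k - a j)
          = Real.pi / (4 * d) * (a k - x) - Real.pi / (4 * d) * (a j - x) := by ring
      rw [this, ← tanh_sub_div, ← inv_div ((β k : ℂ) - β j), Complex.ofReal_div,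
        Complex.ofReal_sub, Complex.ofReal_sub, Complex.ofReal_mul, Complex.ofReal_one]
    have h3 : deriv (tanhMap d) ((x : ℂ) - a k) / deriv (tanhMap d) 0 = 1 - (β k : ℂ) ^ 2 := by
      rw [← Complex.ofReal_sub, deriv_tanhMap_div_deriv_zero hd, ← neg_sub (a k) x, mul_neg,
        Real.tanh_neg, Complex.ofReal_neg, neg_sq]
    rw [h3, h1, hgβ, discWeight, ← h2]
    simp only [div_eq_mul_inv, mul_inv]
    ring
  have hfac : f x - interpolant d w a f x = w x * (g 0 - ∑ k, g (β k) * discWeight β k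
      * ∏ j ∈ Finset.univ.erase k, (-(β j : ℂ))) := by
    rw [mul_sub, ← hsum, hg0, mul_div_cancel₀ _ hwx]
  rw [hfac, norm_mul]
  exact mul_le_mul_of_nonneg_left hmain (norm_nonneg _)

end WeightedHardy

theorem mainTheorem1 (d : ℝ) (hd : 0 < d) (w : ℂ → ℂ) (hw : WeightedHardy.IsWeight d w)
    (n : ℕ) (hn : 2 ≤ n) (aStar : Fin n → ℝ)
    (ha : WeightedHardy.IsEnergyMinimizer d w aStar) :
    WeightedHardy.worstError d w aStar
      ≤ ENNReal.ofReal (Real.exp (-(WeightedHardy.discreteF d w aStar / (n : ℝ)))) := by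
  refine iSup₂_le fun f hf => iSup_le fun x => ?_
  rw [← ofReal_norm]
  exact ENNReal.ofReal_le_ofReal ((WeightedHardy.norm_sub_interpolant_le hd hw
    (StrictMono.injective ha.1) hf.1 hf.2 x).trans (ha.mul_prod_abs_tanh_le hd hw hn x))
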